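/- Let $k\ge 0$ and let $V_1,\dots,V_k$ be pairwise disjoint finite sets (the node sets of $k$ QNets) with $|V_a|=n_a$. Let $G=G_{n_1,\dots,n_k}=(V_1\cup\dots\cup V_k,E)$ be a graph all of whose edges (inter-links) join nodes of two different sets $V_a\ne V_b$, and let $\bar G=\bar G_{n_1,\dots,n_k}$ be the graph on the same nodes in which $u\in V_a$ and $v\in V_b$ are adjacent if and only if $a\neq b$ and $\{u,v\}\notin E$. Put $k'=k+(k\bmod 2)$ and let $CG=CG_{n_1,\dots,n_k}$ be the graph obtained from $G$ by adding $k'$ control nodes $c_1,\dots,c_{k'}$, all pairs of which are joined, and by joining $c_a$ to every node of $V_a$ for $1\le a\le k$. For a finite graph $H$, let $|H\rangle=\prod_{e\in E(H)}CZ_e\,|+\rangle^{\otimes V(H)}$ be its graph state, and let $|x,\pm\rangle=(|0\rangle\pm|1\rangle)/\sqrt2$. Measure the Pauli observable $\sigma_x$ on each of the control nodes $c_1,\dots,c_{k'}$ of $|CG\rangle$, successively and in any order. Then every sequence of outcomes $s=(s_1,\dots,s_{k'})\in\{+,-\}^{k'}$ can occur, and for each $s$ there is an operator $U_s$ on the qubits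 $V_1\cup\dots\cup V_k$, not depending on the order of the measurements, which is a tensor product of Pauli matrices $1,\sigma_x,\sigma_y,\sigma_z$ up to a global phase in $\{\pm1,\pm i\}$, such that the normalized state after the measurements with outcomes $s$ is $$\bigotimes_{j=1}^{k'}|x,s_j\rangle^{(c_j)}\otimes U_s\,|\bar G_{n_1,\dots,n_k}\rangle .$$ -/

import Mathlib

namespace MEC

/-! ### Inter-QNets and the associated graphs -/

/-- The nodes of `k` QNets `V_1, …, V_k` with `|V_a| = n a`; the node `v_{a.i}` is `⟨a, i⟩`. -/
abbrev Node {k : ℕ} (n : Fin k → ℕ) : Type := Σ a : Fin k, Fin (n a)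

/-- The graph `G_{n_1,…,n_k} = (V_1, …, V_k, E)`: every edge is an inter-link, that is, it joins
nodes of two different QNets. -/
structure InterQNet {k : ℕ} (n : Fin k → ℕ) where
  /-- the graph of the inter-links -/
  graph : SimpleGraph (Node n)
  /-- edges join different QNets only -/
  inter : ∀ u v, graph.Adj u v → u.1 ≠ v.1

/-- The complement Inter-QNet: same QNets, and two nodes of different QNets are joined exactly when
they are not joined in `G`. -/
def InterQNet.complement {k : ℕ} {n : Fin k → ℕ} (G : InterQNet n) : InterQNet n where
  graph :=
    { Adj := fun u v => u.1 ≠ v.1 ∧ ¬ G.graph.Adj u v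
      symm := ⟨fun _ _ h => ⟨h.1.symm, fun h' => h.2 h'.symm⟩⟩
      loopless := ⟨fun _ h => h.1 rfl⟩ }
  inter := fun _ _ h => h.1

/-- The number `k' = k + (k mod 2)` of control nodes. -/
abbrev numControl (k : ℕ) : ℕ := k + k % 2

/-- Adjacency of the controlled Inter-QNet graph: the inter-links of `G`, all pairs of distinct
control nodes, and all pairs of a node of `V_a` and the control node `c_a`. -/
def controlledAdj {k : ℕ} {n : Fin k → ℕ} (G : InterQNet n) :
    Node n ⊕ Fin (numControl k) → Node n ⊕ Fin (numControl k) → Prop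
  | Sum.inl u, Sum.inl v => G.graph.Adj u v
  | Sum.inl u, Sum.inr c => (u.1 : ℕ) = (c : ℕ)
  | Sum.inr c, Sum.inl u => (u.1 : ℕ) = (c : ℕ)
  | Sum.inr c, Sum.inr d => c ≠ d

/-- The controlled Inter-QNet graph `CG_{n_1,…,n_k}`. -/
def InterQNet.controlled {k : ℕ} {n : Fin k → ℕ} (G : InterQNet n) :
    SimpleGraph (Node n ⊕ Fin (numControl k)) where
  Adj := controlledAdj G
  symm := ⟨by
    rintro (u | c) (v | d) h
    · exact SimpleGraph.Adj.symm h
    · exact h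
    · exact h
    · exact Ne.symm h⟩
  loopless := ⟨by
    rintro (u | c) h
    · exact G.graph.irrefl h
    · exact h rfl⟩

/-! ### Qubit registers, graph states, Pauli operators, measurements -/

/-- The Hilbert space `⨂_{v ∈ V} ℂ²` of one qubit per element of `V`, in the computational basis
`|x⟩`, `x ∈ {0,1}^V`. -/
abbrev QState (V : Type) [Fintype V] : Type := EuclideanSpace ℂ (V → Fin 2)

/-- The phase with which the controlled-Z gate on the pair `e` multiplies `|x⟩`. -/
noncomputable def czPhase {V : Type} (e : Sym2 V) (x : V → Fin 2) : ℂ :=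
  open Classical in if ∀ v ∈ e, x v = 1 then -1 else 1

/-- The graph state `|G⟩ = ∏_{e ∈ E(G)} CZ_e |+⟩^{⊗V}`. -/
noncomputable def graphState {V : Type} [Fintype V] [DecidableEq V] (G : SimpleGraph V) : QState V :=
  open Classical in
  WithLp.toLp 2 fun x =>
    (∏ e ∈ G.edgeFinset, czPhase e x) * ((1 / Real.sqrt 2 : ℝ) : ℂ) ^ Fintype.card V

/-- The operator `⨂_v M_v` on a register. -/
def tensorOp {V : Type} [Fintype V] (M : V → Matrix (Fin 2) (Fin 2) ℂ) :
    Matrix (V → Fin 2) (V → Fin 2) ℂ :=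
  Matrix.of fun x y => ∏ v, M v (x v) (y v)

/-- The one-qubit operator `A` acting on qubit `v`, and the identity on all other qubits. -/
def onQubit {V : Type} [Fintype V] [DecidableEq V] (v : V) (A : Matrix (Fin 2) (Fin 2) ℂ) :
    Matrix (V → Fin 2) (V → Fin 2) ℂ :=
  tensorOp (Pi.mulSingle v A)

/-- The Pauli matrix `σ_x`. -/
def pauliX : Matrix (Fin 2) (Fin 2) ℂ := !![0, 1; 1, 0]

/-- The Pauli matrix `σ_y`. -/
noncomputable def pauliY : Matrix (Fin 2) (Fin 2) ℂ := !![0, -Complex.I; Complex.I, 0]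

/-- The Pauli matrix `σ_z`. -/
def pauliZ : Matrix (Fin 2) (Fin 2) ℂ := !![1, 0; 0, -1]

/-- `U` is a local Pauli operator (an element of the Pauli group): a tensor product of matrices
`1, σ_x, σ_y, σ_z`, up to a global phase in `{1, i, -1, -i}`. -/
def IsLocalPauli {V : Type} [Fintype V] (U : Matrix (V → Fin 2) (V → Fin 2) ℂ) : Prop :=
  ∃ (r : Fin 4) (P : V → Matrix (Fin 2) (Fin 2) ℂ),
    (∀ v, P v = 1 ∨ P v = pauliX ∨ P v = pauliY ∨ P v = pauliZ) ∧
      U = Complex.I ^ (r : ℕ) • tensorOp P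

/-- The projector `(1 + s σ_x^{(c)}) / 2` onto the eigenspace of `σ_x^{(c)}` for the
eigenvalue `s = ±1`. -/
noncomputable def projX {V : Type} [Fintype V] [DecidableEq V] (c : V) (s : ℤˣ) :
    Matrix (V → Fin 2) (V → Fin 2) ℂ :=
  (1 / 2 : ℂ) • (1 + ((s : ℤ) : ℂ) • onQubit c pauliX)

/-- The normalized state after a measurement of `σ_x` on qubit `c` of `ψ` with outcome `s`; it is
`0` exactly when the outcome is impossible. -/
noncomputable def postX {V : Type} [Fintype V] [DecidableEq V] (c : V) (s : ℤˣ) (ψ : QState V) :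
    QState V :=
  ((‖Matrix.toEuclideanLin (projX c s) ψ‖⁻¹ : ℝ) : ℂ) • Matrix.toEuclideanLin (projX c s) ψ

/-- The state after successive measurements of `σ_x` on the qubits `f c`, for `c` in the list `l`,
in this order, with outcomes `s c`. -/
noncomputable def postXList {V C : Type} [Fintype V] [DecidableEq V] (f : C → V) (s : C → ℤˣ)
    (l : List C) (ψ : QState V) : QState V :=
  l.foldl (fun φ c => postX (f c) (s c) φ) ψ

/-- The product state `⨂_c |x, s_c⟩`, with `|x, ±⟩ = (|0⟩ ± |1⟩) / √2`. -/
noncomputable def xKet {C : Type} [Fintype C] (s : C → ℤˣ) : QState C :=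
  WithLp.toLp 2 fun y =>
    ∏ c, ((1 / Real.sqrt 2 : ℝ) : ℂ) * (if y c = 0 then 1 else ((s c : ℤ) : ℂ))

/-- The product `φ ⊗ χ` of states of two registers, as a state of the joint register. -/
noncomputable def tensorState {V C : Type} [Fintype V] [Fintype C] (φ : QState V) (χ : QState C) :
    QState (V ⊕ C) :=
  WithLp.toLp 2 fun z => φ (fun v => z (Sum.inl v)) * χ (fun c => z (Sum.inr c))

end MEC

/-!
The amplitude of a graph state at the bit string `x` is, up to normalization, `(-1)` to the number
of edges both of whose ends carry the bit `1` (`graphState_apply`). Projecting all control qubits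
on the states `|x, s_c⟩` gives the product of these states with the contraction of the control
register (`projXList_inr_apply`); the projectors commute, so the order of the measurements plays
no role, and normalizing after each step amounts to normalizing once (`postXList_eq`).

Write `s_c = (-1)^(σ_c)`, and let `w_c` be the number of nodes of `V_c` that carry the bit `1`. For
a fixed bit string `x` of the nodes, the contraction is the phase of `G` at `x` times the sum over
`y` of `(-1)^(∑_c (w_c + σ_c) y_c + ∑_{c<d} y_c y_d)`, a quadratic Gauss sum. As the number of
control nodes is an even number `2h`, this sum is real, equal to `2^h` times `(-1)` to the power
`h(h-1)/2 + (h+1) ∑_c t_c + ∑_{c<d} t_c t_d` with `t = w + σ` (`quadGaussSum_eq`). The part of the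
exponent quadratic in `w` is `∑_{c<d} w_c w_d`, which counts all pairs of `1`-nodes in different
QNets, that is, the edges of `G` and those of its complement
(`edgeCount_add_edgeCount_complement`). So the phase of `G` turns into that of its complement. The
part linear in `w` is a product of `σ_z`s on the nodes, and the constant part is a global sign:
together they form the byproduct operator `zOp`.
-/

namespace MEC

/-! ### Amplitudes and norms -/

section
variable {V : Type} [Fintype V] [DecidableEq V]

theorem czPhase_mk {V : Type} (u v : V) (x : V → Fin 2) :
    czPhase s(u, v) x = (-1) ^ ((x u : ℕ) * (x v : ℕ)) := by
  unfold czPhase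
  simp only [Sym2.mem_iff, forall_eq_or_imp, forall_eq]
  generalize x u = a
  generalize x v = b
  fin_cases a <;> fin_cases b <;> simp

open Classical in
/-- The number of edges of `H` both of whose ends carry the bit `1` in `x`. To count each edge
once, it is read in the direction singled out by the relation `R`. -/
noncomputable def edgeCount {V : Type} [Fintype V] (H : SimpleGraph V) (R : V → V → Prop)
    (x : V → Fin 2) : ℕ :=
  ∑ u, ∑ v, if H.Adj u v ∧ R u v then (x u : ℕ) * (x v : ℕ) else 0

theorem graphState_apply (H : SimpleGraph V) (R : V → V → Prop)
    (hR : ∀ u v, H.Adj u v → (R u v ↔ ¬ R v u)) (x : V → Fin 2) :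
    graphState H x =
      (-1) ^ edgeCount H R x * ((1 / Real.sqrt 2 : ℝ) : ℂ) ^ Fintype.card V := by
  classical
  unfold graphState edgeCount
  simp only
  congr 1
  rw [← Fintype.sum_prod_type', ← Finset.sum_filter, ← Finset.prod_pow_eq_pow_sum]
  symm
  refine Finset.prod_bij (fun p _ => s(p.1, p.2)) ?_ ?_ ?_ ?_
  · rintro ⟨u, v⟩ h
    simp only [Finset.mem_filter] at h
    simpa using h.2.1
  · rintro ⟨u, v⟩ h ⟨u', v'⟩ h' e
    simp only [Finset.mem_filter, Finset.mem_univ, true_and] at h h'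
    rcases Sym2.eq_iff.1 e with ⟨rfl, rfl⟩ | ⟨h1, h2⟩
    · rfl
    · simp only at h1 h2
      subst h1 h2
      exact absurd h'.2 ((hR _ _ h.1).1 h.2)
  · intro e
    induction e using Sym2.ind with
    | _ u v =>
      intro h
      have h : H.Adj u v := by simpa using h
      by_cases hr : R u v
      · exact ⟨(u, v), by simp [h, hr], rfl⟩
      · exact ⟨(v, u), by simp [h.symm, (hR _ _ h.symm).2 hr], Sym2.eq_swap⟩
  · rintro ⟨u, v⟩ _
    exact (czPhase_mk u v x).symm

/-- A state all of whose amplitudes have the same modulus as those of `|+⟩^{⊗V}` is normalized. -/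
theorem norm_eq_one_of_norm_apply (ψ : QState V)
    (h : ∀ x, ‖ψ x‖ = (1 / Real.sqrt 2) ^ Fintype.card V) : ‖ψ‖ = 1 := by
  have h2 : ((1 / Real.sqrt 2) ^ Fintype.card V) ^ 2 = ((2 : ℝ) ^ Fintype.card V)⁻¹ := by
    rw [← pow_mul, mul_comm, pow_mul]
    simp
  rw [EuclideanSpace.norm_eq]
  simp_rw [h, h2]
  simp

theorem norm_graphState (H : SimpleGraph V) : ‖graphState H‖ = 1 := by
  classical
  refine norm_eq_one_of_norm_apply _ fun x => ?_
  -- Any linear order on the nodes serves to direct the edges.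
  let e := Fintype.equivFin V
  rw [graphState_apply H (fun u v => e u < e v) fun u v h => ?_]
  · simp [abs_of_nonneg (Real.sqrt_nonneg 2)]
  · have : e u ≠ e v := fun h' => h.ne (e.injective h')
    omega

/-! ### Products of one-qubit operators -/

theorem tensorOp_mul (A B : V → Matrix (Fin 2) (Fin 2) ℂ) :
    tensorOp A * tensorOp B = tensorOp (A * B) := by
  ext x y
  simp only [tensorOp, Matrix.mul_apply, Matrix.of_apply, Pi.mul_apply, ← Finset.prod_mul_distrib]
  exact (Fintype.prod_sum fun v j => A v (x v) j * B v j (y v)).symm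

omit [DecidableEq V] in
theorem tensorOp_diagonal (d : V → Fin 2 → ℂ) :
    tensorOp (fun v => Matrix.diagonal (d v)) = Matrix.diagonal fun x => ∏ v, d v (x v) := by
  ext x y
  simp only [tensorOp, Matrix.of_apply, Matrix.diagonal_apply]
  split_ifs with h
  · simp [h]
  · obtain ⟨v, hv⟩ := Function.ne_iff.1 h
    exact Finset.prod_eq_zero (Finset.mem_univ v) (if_neg hv)

omit [DecidableEq V] in
theorem tensorOp_one : tensorOp (1 : V → Matrix (Fin 2) (Fin 2) ℂ) = 1 := by
  have h := tensorOp_diagonal (V := V) fun _ _ => 1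
  simpa [Pi.one_def] using h

/-- The coefficients `⟨a|x, s⟩`, up to the factor `1 / √2`. -/
def xSign (s : ℤˣ) (a : Fin 2) : ℂ := if a = 0 then 1 else ((s : ℤ) : ℂ)

/-- The projector `|x, s⟩⟨x, s|` of a single qubit. -/
noncomputable def projX₁ (s : ℤˣ) : Matrix (Fin 2) (Fin 2) ℂ :=
  Matrix.of fun a b => 1 / 2 * xSign s a * xSign s b

/-- The matrix `|x, s⟩⟨x, s|` is `(1 + s σ_x) / 2`. -/
theorem projX₁_eq (s : ℤˣ) : projX₁ s = (1 / 2 : ℂ) • (1 + ((s : ℤ) : ℂ) • pauliX) := by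
  ext a b
  rcases Int.units_eq_one_or s with rfl | rfl <;> fin_cases a <;> fin_cases b <;>
    simp [projX₁, xSign, pauliX]

theorem projX_eq_tensorOp (c : V) (s : ℤˣ) : projX c s = tensorOp (Pi.mulSingle c (projX₁ s)) := by
  ext x y
  have key (A : Matrix (Fin 2) (Fin 2) ℂ) : tensorOp (Pi.mulSingle c A) x y =
      A (x c) (y c) * ∏ v ∈ Finset.univ.erase c, (1 : Matrix (Fin 2) (Fin 2) ℂ) (x v) (y v) := by
    rw [tensorOp, Matrix.of_apply, ← Finset.mul_prod_erase _ _ (Finset.mem_univ c)]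
    simp only [Pi.mulSingle_eq_same]
    congr 1
    refine Finset.prod_congr rfl fun v hv => ?_
    rw [Pi.mulSingle_eq_of_ne (Finset.ne_of_mem_erase hv)]
  have h1 := key 1
  rw [Pi.mulSingle_one, tensorOp_one] at h1
  simp only [projX, onQubit, Matrix.smul_apply, Matrix.add_apply, key, h1, projX₁_eq, smul_eq_mul]
  ring

end

theorem xSign_eq_neg_one_pow {s : ℤˣ} {σ : ℕ} (h : ((s : ℤ) : ℂ) = (-1) ^ σ) (a : Fin 2) :
    xSign s a = (-1) ^ (σ * (a : ℕ)) := by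
  rw [xSign, h]
  fin_cases a <;> simp

theorem xKet_apply {C : Type} [Fintype C] (s : C → ℤˣ) (y : C → Fin 2) :
    xKet s y = ((1 / Real.sqrt 2 : ℝ) : ℂ) ^ Fintype.card C * ∏ c, xSign (s c) (y c) := by
  change ∏ c, ((1 / Real.sqrt 2 : ℝ) : ℂ) * xSign (s c) (y c) = _
  rw [Finset.prod_mul_distrib, Finset.prod_const, Finset.card_univ]

theorem norm_xSign (s : ℤˣ) (a : Fin 2) : ‖xSign s a‖ = 1 := by
  rcases Int.units_eq_one_or s with rfl | rfl <;> fin_cases a <;> simp [xSign]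

/-! ### Successive measurements -/

section
variable {V C : Type} [Fintype V] [DecidableEq V]

theorem postX_pos_smul (c : V) (s : ℤˣ) (r : ℝ) (hr : 0 < r) (ψ : QState V) :
    postX c s ((r : ℂ) • ψ) = postX c s ψ := by
  have : (r : ℂ) ≠ 0 := by exact_mod_cast hr.ne'
  simp only [postX, map_smul, norm_smul, Complex.norm_real, Real.norm_eq_abs, abs_of_pos hr,
    smul_smul]
  congr 1
  push_cast
  field_simp

/-- The unnormalized state after the measurements. -/
noncomputable def projXList (f : C → V) (s : C → ℤˣ) (l : List C) (ψ : QState V) : QState V :=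
  l.foldl (fun φ c => Matrix.toEuclideanLin (projX (f c) (s c)) φ) ψ

/-- Normalizing after each measurement amounts to normalizing once, at the end. -/
theorem postXList_eq (f : C → V) (s : C → ℤˣ) (l : List C) (ψ : QState V) (hψ : ‖ψ‖ = 1)
    (h : projXList f s l ψ ≠ 0) :
    postXList f s l ψ = ((‖projXList f s l ψ‖⁻¹ : ℝ) : ℂ) • projXList f s l ψ := by
  induction l using List.reverseRecOn with
  | nil => simp [projXList, postXList, hψ]
  | append_singleton l c ih =>
    have hl : projXList f s l ψ ≠ 0 := by
      intro h0
      apply h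
      simp only [projXList, List.foldl_append, List.foldl_cons, List.foldl_nil] at h0 ⊢
      rw [h0, map_zero]
    have e := ih hl
    simp only [projXList, postXList, List.foldl_append, List.foldl_cons, List.foldl_nil] at e hl ⊢
    rw [e, postX_pos_smul _ _ _ (inv_pos.2 (norm_pos_iff.2 hl)), postX]

/-- The factor `r` has to be a positive real number, so that no phase is lost: the measured state is
`φ` itself, not merely a multiple of it. -/
theorem postXList_eq_of_projXList_eq (f : C → V) (s : C → ℤˣ) (l : List C) (ψ φ : QState V)
    (hψ : ‖ψ‖ = 1) (hφ : ‖φ‖ = 1) (r : ℝ) (hr : 0 < r)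
    (h : projXList f s l ψ = (r : ℂ) • φ) : postXList f s l ψ = φ := by
  have hr' : (r : ℂ) ≠ 0 := by exact_mod_cast hr.ne'
  have hn : ‖projXList f s l ψ‖ = r := by
    rw [h, norm_smul, hφ, Complex.norm_real, Real.norm_eq_abs, abs_of_pos hr, mul_one]
  rw [postXList_eq f s l ψ hψ (by rw [← norm_pos_iff, hn]; exact hr), hn, h, smul_smul]
  push_cast
  rw [inv_mul_cancel₀ hr', one_smul]

/-- The composite of the projectors is a product operator whose factors depend only on which
qubits have been measured, hence not on the order. -/
theorem projXList_inr_eq_tensorOp [Fintype C] [DecidableEq C] (s : C → ℤˣ) (l : List C)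
    (hl : l.Nodup) (ψ : QState (V ⊕ C)) :
    projXList Sum.inr s l ψ = Matrix.toEuclideanLin
      (tensorOp (Sum.elim 1 fun c => if c ∈ l then projX₁ (s c) else 1)) ψ := by
  induction l using List.reverseRecOn with
  | nil =>
    have : (Sum.elim 1 fun _ => 1 : V ⊕ C → Matrix (Fin 2) (Fin 2) ℂ) = 1 := by
      ext (v | c) <;> rfl
    simp [projXList, this, tensorOp_one]
  | append_singleton l c ih =>
    have hc : c ∉ l := by
      intro h
      exact (List.nodup_append.1 hl).2.2 c h c (by simp) rfl
    have e := ih (hl.sublist (List.sublist_append_left _ _))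
    simp only [projXList, List.foldl_append, List.foldl_cons, List.foldl_nil] at e ⊢
    rw [e, projX_eq_tensorOp, ← LinearMap.comp_apply]
    simp only [Matrix.toEuclideanLin]
    rw [← Matrix.toLpLin_mul_same, tensorOp_mul]
    congr 3
    ext1 (v | d)
    · simp
    · by_cases hd : d = c
      · subst hd
        simp [hc]
      · simp [hd]

/-- Projecting every qubit of the second register on its state `|x, s_c⟩` contracts that register
with `⨂_c ⟨x, s_c|`. -/
theorem projXList_inr_apply [Fintype C] [DecidableEq C] (s : C → ℤˣ) (l : List C) (hl : l.Nodup)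
    (hC : ∀ c, c ∈ l) (ψ : QState (V ⊕ C)) (x : V → Fin 2) (y : C → Fin 2) :
    projXList Sum.inr s l ψ (Sum.elim x y) =
      (1 / 2) ^ Fintype.card C * (∏ c, xSign (s c) (y c)) *
        ∑ y', (∏ c, xSign (s c) (y' c)) * ψ (Sum.elim x y') := by
  have hs : projXList Sum.inr s l ψ = Matrix.toEuclideanLin
      (tensorOp (Sum.elim 1 fun c => projX₁ (s c))) ψ := by
    rw [projXList_inr_eq_tensorOp s l hl ψ]
    simp [hC]
  rw [hs]
  simp only [Matrix.toEuclideanLin, Matrix.toLpLin_apply, Matrix.mulVec, dotProduct]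
  rw [← (Equiv.sumArrowEquivProdArrow V C (Fin 2)).symm.sum_comp, Fintype.sum_prod_type,
    Finset.sum_eq_single x]
  · rw [Finset.mul_sum]
    refine Finset.sum_congr rfl fun y' _ => ?_
    have : (Equiv.sumArrowEquivProdArrow V C (Fin 2)).symm (x, y') = Sum.elim x y' := rfl
    rw [this]
    simp only [tensorOp, projX₁, Matrix.of_apply, Fintype.prod_sum_type, Sum.elim_inl,
      Sum.elim_inr, Finset.prod_mul_distrib, Finset.prod_const, Finset.card_univ]
    have h1 : ∏ v : V, (1 : V → Matrix (Fin 2) (Fin 2) ℂ) v (x v) (x v) = 1 :=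
      Finset.prod_eq_one fun v _ => Matrix.one_apply_eq (x v)
    erw [h1]
    ring
  · intro x' _ hx
    refine Finset.sum_eq_zero fun y' _ => ?_
    obtain ⟨v, hv⟩ := Function.ne_iff.1 hx
    rw [tensorOp, Matrix.of_apply, Finset.prod_eq_zero (Finset.mem_univ (Sum.inl v)), zero_mul]
    exact Matrix.one_apply_ne hv.symm
  · simp

end

/-! ### The quadratic Gauss sum of the complete graph -/

/-- The second elementary symmetric function `∑_{c < d} t_c t_d`. -/
def pairSum {m : ℕ} (t : Fin m → ℕ) : ℕ := ∑ c, ∑ d, if c < d then t c * t d else 0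

theorem cons_add_one {m : ℕ} (a : ℕ) (t : Fin m → ℕ) :
    (fun c => (Fin.cons a t : Fin (m + 1) → ℕ) c + 1) = Fin.cons (a + 1) fun c => t c + 1 := by
  funext c
  refine Fin.cases ?_ (fun _ => ?_) c <;> simp

theorem pairSum_cons {m : ℕ} (a : ℕ) (t : Fin m → ℕ) :
    pairSum (Fin.cons a t : Fin (m + 1) → ℕ) = a * ∑ c, t c + pairSum t := by
  simp [pairSum, Fin.sum_univ_succ, Finset.mul_sum]

theorem pairSum_add {m : ℕ} (w t : Fin m → ℕ) :
    pairSum (fun c => w c + t c) =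
      pairSum w + ∑ c, w c * ∑ d ∈ Finset.univ.erase c, t d + pairSum t := by
  have hswap : ∑ c, ∑ d, (if d < c then w c * t d else 0) =
      ∑ c, ∑ d, if c < d then w d * t c else 0 := Finset.sum_comm
  have hne : ∑ c, w c * ∑ d ∈ Finset.univ.erase c, t d =
      ∑ c, ∑ d, ((if c < d then w c * t d else 0) + if d < c then w c * t d else 0) := by
    refine Finset.sum_congr rfl fun c _ => ?_
    rw [Finset.mul_sum, ← Finset.filter_ne, Finset.sum_filter]
    refine Finset.sum_congr rfl fun d _ => ?_
    rcases lt_trichotomy c d with h | h | h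
    · simp [h, h.ne, h.not_gt]
    · simp [h]
    · simp [h, h.ne', h.not_gt]
  rw [hne]
  simp only [Finset.sum_add_distrib, hswap]
  simp only [pairSum, ← Finset.sum_add_distrib]
  refine Finset.sum_congr rfl fun c _ => Finset.sum_congr rfl fun d _ => ?_
  split_ifs <;> ring

theorem pairSum_add_one {m : ℕ} (t : Fin m → ℕ) :
    (pairSum fun c => t c + 1) + ∑ c, t c = pairSum t + m * ∑ c, t c + m.choose 2 := by
  induction m with
  | zero => simp [pairSum]
  | succ m ih =>
    obtain ⟨a, t, rfl⟩ : ∃ (a : ℕ) (t' : Fin m → ℕ), t = (Fin.cons a t' : Fin (m + 1) → ℕ) :=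
      ⟨t 0, Fin.tail t, (Fin.cons_self_tail t).symm⟩
    rw [cons_add_one, pairSum_cons, pairSum_cons, Nat.choose_succ_succ' m 1]
    have := ih t
    simp only [Fin.sum_univ_succ, Fin.cons_zero, Fin.cons_succ, Finset.sum_add_distrib,
      Finset.sum_const, Finset.card_univ, Fintype.card_fin, smul_eq_mul, Nat.choose_one_right]
    linear_combination this

/-- The sum `∑_y (-1)^{t·y + ∑_{c<d} y_c y_d}` over all bit strings `y`. -/
noncomputable def quadGaussSum {m : ℕ} (t : Fin m → ℕ) : ℂ :=
  ∑ y : Fin m → Fin 2, (-1) ^ (∑ c, t c * (y c : ℕ) + pairSum fun c => (y c : ℕ))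

/-- Splitting off the first bit: if it is `1`, its products with the other bits raise every
coefficient of the linear form by one. -/
theorem quadGaussSum_cons {m : ℕ} (a : ℕ) (t : Fin m → ℕ) :
    quadGaussSum (Fin.cons a t : Fin (m + 1) → ℕ) =
      quadGaussSum t + (-1) ^ a * quadGaussSum fun c => t c + 1 := by
  unfold quadGaussSum
  rw [← (Fin.consEquiv fun _ => Fin 2).sum_comp, Fintype.sum_prod_type]
  simp only [Fin.sum_univ_two, Finset.mul_sum]
  have hc (b : Fin 2) (y : Fin m → Fin 2) :
      (fun c => ((Fin.consEquiv (fun _ : Fin (m + 1) => Fin 2) (b, y) c : Fin 2) : ℕ)) =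
        Fin.cons (b : ℕ) fun c => (y c : ℕ) := by
    funext c
    refine Fin.cases ?_ (fun _ => ?_) c <;> simp [Fin.consEquiv]
  simp only [hc, pairSum_cons]
  congr 1 <;> refine Finset.sum_congr rfl fun y _ => ?_
  · simp [Fin.sum_univ_succ, Fin.consEquiv]
  · simp [Fin.sum_univ_succ, Fin.consEquiv, add_mul, Finset.sum_add_distrib]
    ring

theorem quadGaussSum_add_two {m : ℕ} (t : Fin m → ℕ) :
    (quadGaussSum fun c => t c + 1 + 1) = quadGaussSum t := by
  refine Finset.sum_congr rfl fun y _ => ?_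
  have : ∑ c, (t c + 1 + 1) * (y c : ℕ) = ∑ c, t c * (y c : ℕ) + 2 * ∑ c, (y c : ℕ) := by
    rw [Finset.mul_sum, ← Finset.sum_add_distrib]
    exact Finset.sum_congr rfl fun _ _ => by ring
  rw [this, pow_add, pow_add, pow_add, pow_mul]
  simp

theorem neg_one_pow_eq_of_even_add {a b : ℕ} (h : Even (a + b)) : (-1 : ℂ) ^ a = (-1) ^ b := by
  have h' : (-1 : ℂ) ^ a * (-1) ^ b = 1 := by rw [← pow_add, h.neg_one_pow]
  rcases neg_one_pow_eq_or ℂ b with hb | hb <;> rw [hb] at h' ⊢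
  · linear_combination h'
  · linear_combination -h'

/-- For an even number `2h` of bits the sum is `± 2^h`. The proof splits off two bits at a time. -/
theorem quadGaussSum_eq (h : ℕ) : ∀ t : Fin (2 * h) → ℕ,
    quadGaussSum t = 2 ^ h * (-1) ^ (h.choose 2 + (h + 1) * ∑ c, t c + pairSum t) := by
  induction h with
  | zero =>
    intro t
    simp [quadGaussSum, pairSum]
  | succ h ih =>
    intro t
    obtain ⟨a, b, t, rfl⟩ : ∃ (a b : ℕ) (t' : Fin (2 * h) → ℕ),
        t = (Fin.cons a (Fin.cons b t' : Fin (2 * h + 1) → ℕ) : Fin (2 * h + 1 + 1) → ℕ) :=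
      ⟨t 0, Fin.tail t 0, Fin.tail (Fin.tail t), by rw [Fin.cons_self_tail, Fin.cons_self_tail]⟩
    -- The index type is written as a double successor, for `Fin.cons` to be recognized.
    change quadGaussSum
        (Fin.cons a (Fin.cons b t : Fin (2 * h + 1) → ℕ) : Fin (2 * h + 1 + 1) → ℕ) =
      2 ^ (h + 1) * (-1) ^ ((h + 1).choose 2 + (h + 1 + 1) * ∑ c : Fin (2 * h + 1 + 1),
        (Fin.cons a (Fin.cons b t : Fin (2 * h + 1) → ℕ) : Fin (2 * h + 1 + 1) → ℕ) c +
        pairSum (Fin.cons a (Fin.cons b t : Fin (2 * h + 1) → ℕ) : Fin (2 * h + 1 + 1) → ℕ))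
    rw [quadGaussSum_cons, cons_add_one, quadGaussSum_cons, quadGaussSum_cons, quadGaussSum_add_two]
    -- Splitting off two bits leaves the sums at `t`, `t + 1` and `t + 2`; the last equals the first.
    have hshift : (quadGaussSum fun c => t c + 1) = (-1) ^ (∑ c, t c + h) * quadGaussSum t := by
      rw [ih, ih t, mul_left_comm, ← pow_add]
      congr 1
      apply neg_one_pow_eq_of_even_add
      have h1 := pairSum_add_one t
      have h2 : (2 * h).choose 2 + h = 2 * (h * h) := by
        rw [Nat.choose_two_right]
        cases h with
        | zero => rfl
        | succ j =>
          rw [show 2 * (j + 1) * (2 * (j + 1) - 1) = 2 * ((j + 1) * (2 * j + 1)) by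
            rw [show 2 * (j + 1) - 1 = 2 * j + 1 by omega]; ring]
          rw [Nat.mul_div_cancel_left _ (by norm_num)]
          ring
      simp only [Finset.sum_add_distrib, Finset.sum_const, Finset.card_univ, Fintype.card_fin,
        smul_eq_mul, mul_one]
      refine ⟨h.choose 2 + (h + 1) * ∑ c, t c + (h + 1) * h + pairSum t + h * ∑ c, t c + h * h, ?_⟩
      linear_combination h1 + h2
    rw [hshift, ih t, pairSum_cons, pairSum_cons, Nat.choose_succ_succ' h 1]
    simp only [Fin.sum_univ_succ, Fin.cons_zero, Fin.cons_succ, Nat.choose_one_right]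
    generalize ∑ c, t c = T
    generalize pairSum t = p
    generalize h.choose 2 = q
    rcases Nat.even_or_odd' a with ⟨a, rfl | rfl⟩ <;>
      rcases Nat.even_or_odd' b with ⟨b, rfl | rfl⟩
    all_goals
      rcases Nat.even_or_odd' h with ⟨h, rfl | rfl⟩ <;>
        rcases Nat.even_or_odd' T with ⟨T, rfl | rfl⟩ <;>
        simp [pow_add, pow_mul, mul_add, add_mul] <;> ring

theorem quadGaussSum_eq_of_eq {m h : ℕ} (hm : m = 2 * h) (t : Fin m → ℕ) :
    quadGaussSum t = 2 ^ h * (-1) ^ (h.choose 2 + (h + 1) * ∑ c, t c + pairSum t) := by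
  subst hm
  exact quadGaussSum_eq h t

/-! ### The controlled graph -/

section
variable {k : ℕ} {n : Fin k → ℕ}

/-- The number of nodes of the QNet controlled by `c` that carry the bit `1`; it is `0` for the
additional control node when `k` is odd. -/
def weight (x : Node n → Fin 2) (c : Fin (numControl k)) : ℕ :=
  ∑ u : Node n, if Fin.castAdd (k % 2) u.1 = c then (x u : ℕ) else 0

theorem sum_weight_mul (x : Node n → Fin 2) (f : Fin (numControl k) → ℕ) :
    ∑ c, weight x c * f c = ∑ u : Node n, (x u : ℕ) * f (Fin.castAdd (k % 2) u.1) := by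
  simp only [weight, Finset.sum_mul]
  rw [Finset.sum_comm]
  simp

/-- `pairSum (weight x)` counts the pairs of nodes in different QNets that both carry the bit `1`. -/
theorem pairSum_weight (x : Node n → Fin 2) :
    pairSum (weight x) =
      ∑ u : Node n, ∑ v : Node n, if u.1 < v.1 then (x u : ℕ) * (x v : ℕ) else 0 := by
  have h (c : Fin (numControl k)) : (∑ d, if c < d then weight x c * weight x d else 0) =
      weight x c * ∑ d, weight x d * if c < d then 1 else 0 := by
    rw [Finset.mul_sum]
    exact Finset.sum_congr rfl fun d _ => by split_ifs <;> simp
  simp only [pairSum, h]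
  rw [sum_weight_mul]
  refine Finset.sum_congr rfl fun u _ => ?_
  rw [sum_weight_mul, Finset.mul_sum]
  exact Finset.sum_congr rfl fun v _ => by
    simp [show Fin.castAdd (k % 2) u.1 < Fin.castAdd (k % 2) v.1 ↔ u.1 < v.1 from Iff.rfl]

/-- The pairs of nodes in different QNets are the edges of `G` and those of its complement. -/
theorem edgeCount_add_edgeCount_complement (G : InterQNet n) (x : Node n → Fin 2) :
    edgeCount G.graph (fun u v => u.1 < v.1) x +
      edgeCount G.complement.graph (fun u v => u.1 < v.1) x = pairSum (weight x) := by
  classical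
  rw [pairSum_weight]
  simp only [edgeCount, ← Finset.sum_add_distrib]
  refine Finset.sum_congr rfl fun u _ => Finset.sum_congr rfl fun v _ => ?_
  by_cases h : u.1 < v.1 <;> by_cases h' : G.graph.Adj u v <;>
    simp [InterQNet.complement, h, h', ne_of_lt]

/-- The edges of the controlled graph are directed from the nodes to the control nodes, and among
the control nodes by their order. -/
theorem edgeCount_controlled (G : InterQNet n) (x : Node n → Fin 2)
    (y : Fin (numControl k) → Fin 2) :
    edgeCount G.controlled (Sum.Lex (fun u v => u.1 < v.1) (· < ·)) (Sum.elim x y) =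
      edgeCount G.graph (fun u v => u.1 < v.1) x + ∑ c, weight x c * (y c : ℕ) +
        pairSum fun c => (y c : ℕ) := by
  classical
  rw [sum_weight_mul]
  simp only [edgeCount, Fintype.sum_sum_type, Finset.sum_add_distrib]
  have hVC (u : Node n) :
      (∑ c : Fin (numControl k), if (u.1 : ℕ) = (c : ℕ) then (x u : ℕ) * (y c : ℕ) else 0) =
        (x u : ℕ) * (y (Fin.castAdd (k % 2) u.1) : ℕ) := by
    rw [Finset.sum_eq_single (Fin.castAdd (k % 2) u.1)]
    · simp
    · intro c _ hc
      exact if_neg fun h => hc (Fin.ext h.symm)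
    · simp
  have hCC (c d : Fin (numControl k)) : (¬ c = d ∧ c < d) ↔ c < d :=
    ⟨And.right, fun h => ⟨h.ne, h⟩⟩
  simp [InterQNet.controlled, controlledAdj, hVC, pairSum, add_assoc, hCC]
  congr!

/-- The links of an Inter-QNet are directed by the order of the QNets they join. -/
theorem graphState_inter_apply (G : InterQNet n) (x : Node n → Fin 2) :
    graphState G.graph x = (-1) ^ edgeCount G.graph (fun u v => u.1 < v.1) x *
      ((1 / Real.sqrt 2 : ℝ) : ℂ) ^ Fintype.card (Node n) := by
  refine graphState_apply _ _ (fun u v h => ?_) x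
  have := G.inter u v h
  omega

theorem graphState_controlled_apply (G : InterQNet n) (x : Node n → Fin 2)
    (y : Fin (numControl k) → Fin 2) :
    graphState G.controlled (Sum.elim x y) =
      (-1) ^ (edgeCount G.graph (fun u v => u.1 < v.1) x + ∑ c, weight x c * (y c : ℕ) +
        pairSum fun c => (y c : ℕ)) *
      ((1 / Real.sqrt 2 : ℝ) : ℂ) ^ (Fintype.card (Node n) + numControl k) := by
  rw [graphState_apply _ (Sum.Lex (fun u v => u.1 < v.1) (· < ·)) ?_, edgeCount_controlled]
  · simp
  · rintro (u | c) (v | d) h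
    · have := G.inter u v h
      simp only [Sum.lex_inl_inl]
      omega
    · simp
    · simp
    · have : c ≠ d := h
      simp only [Sum.lex_inr_inr]
      omega

end

/-! ### Byproduct operators -/

theorem pauliZ_pow (t : ℕ) :
    pauliZ ^ t = Matrix.diagonal fun a : Fin 2 => (-1 : ℂ) ^ ((a : ℕ) * t) := by
  have : pauliZ = Matrix.diagonal fun a : Fin 2 => (-1 : ℂ) ^ (a : ℕ) := by
    ext a b
    fin_cases a <;> fin_cases b <;> simp [pauliZ]
  rw [this, Matrix.diagonal_pow]
  congr 1
  funext a
  simp [pow_mul]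

/-- The diagonal operator `± ⨂_v σ_z^{τ_v}`. -/
def zOp {V : Type} [Fintype V] (N : ℕ) (τ : V → ℕ) :
    Matrix (V → Fin 2) (V → Fin 2) ℂ :=
  (-1 : ℂ) ^ N • tensorOp fun v => pauliZ ^ τ v

theorem isLocalPauli_zOp {V : Type} [Fintype V] (N : ℕ) (τ : V → ℕ) : IsLocalPauli (zOp N τ) := by
  refine ⟨if Even N then 0 else 2, fun v => pauliZ ^ τ v, fun v => ?_, ?_⟩
  · beta_reduce
    have h2 : pauliZ ^ 2 = 1 := by
      rw [pauliZ_pow]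
      ext a b
      fin_cases a <;> fin_cases b <;> simp
    rcases Nat.even_or_odd' (τ v) with ⟨t, ht | ht⟩
    · left
      rw [ht, pow_mul, h2, one_pow]
    · right; right; right
      rw [ht, pow_succ, pow_mul, h2, one_pow, one_mul]
  · unfold zOp
    congr 1
    split_ifs with h
    · simp [h.neg_one_pow]
    · simp [(Nat.not_even_iff_odd.1 h).neg_one_pow]

theorem zOp_apply {V : Type} [Fintype V] [DecidableEq V] (N : ℕ) (τ : V → ℕ) (φ : QState V)
    (x : V → Fin 2) :
    Matrix.toEuclideanLin (zOp N τ) φ x = (-1) ^ (N + ∑ v, (x v : ℕ) * τ v) * φ x := by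
  simp only [zOp, pauliZ_pow]
  rw [tensorOp_diagonal fun v a => (-1 : ℂ) ^ ((a : ℕ) * τ v)]
  simp only [Matrix.toEuclideanLin, Matrix.toLpLin_apply, Matrix.smul_mulVec,
    Matrix.mulVec_diagonal, Pi.smul_apply, smul_eq_mul, Finset.prod_pow_eq_pow_sum, pow_add]
  ring

end MEC

open MEC in
theorem lemma1 {k : ℕ} (n : Fin k → ℕ) (G : MEC.InterQNet n)
    (s : Fin (MEC.numControl k) → ℤˣ) :
    ∃ U : Matrix (MEC.Node n → Fin 2) (MEC.Node n → Fin 2) ℂ, MEC.IsLocalPauli U ∧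
      ∀ l : List (Fin (MEC.numControl k)), l.Perm (List.finRange (MEC.numControl k)) →
        MEC.postXList Sum.inr s l (MEC.graphState G.controlled) =
          MEC.tensorState
            (Matrix.toEuclideanLin U (MEC.graphState G.complement.graph)) (MEC.xKet s) := by
  obtain ⟨h, hh⟩ : ∃ h, numControl k = 2 * h := ⟨(k + 1) / 2, by simp only [numControl]; omega⟩
  have hσ (c : Fin (numControl k)) : ∃ σ : ℕ, ((s c : ℤ) : ℂ) = (-1) ^ σ := by
    rcases Int.units_eq_one_or (s c) with hc | hc
    · exact ⟨0, by simp [hc]⟩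
    · exact ⟨1, by simp [hc]⟩
  choose σ hσ using hσ
  -- The part of the sign of the Gauss sum that is linear in the weights, and the constant part.
  let τ : Fin (numControl k) → ℕ := fun c => h + 1 + ∑ d ∈ Finset.univ.erase c, σ d
  let N : ℕ := h.choose 2 + (h + 1) * ∑ c, σ c + pairSum σ
  refine ⟨zOp N fun u => τ (Fin.castAdd (k % 2) u.1), isLocalPauli_zOp _ _, fun l hl => ?_⟩
  refine postXList_eq_of_projXList_eq Sum.inr s l _ _ (norm_graphState _) ?_
    ((1 / 2) ^ numControl k * 2 ^ h) (by positivity) ?_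
  · refine norm_eq_one_of_norm_apply _ fun z => ?_
    simp [tensorState, zOp_apply, graphState_inter_apply, xKet_apply, norm_xSign, pow_add,
      abs_of_nonneg (Real.sqrt_nonneg 2)]
  · ext z
    obtain ⟨x, y, rfl⟩ : ∃ x y, z = Sum.elim x y := ⟨_, _, (Sum.elim_comp_inl_inr z).symm⟩
    rw [projXList_inr_apply s l (hl.nodup_iff.2 (List.nodup_finRange _))
      fun c => hl.mem_iff.2 (List.mem_finRange c)]
    have hsum : ∑ y' : Fin (numControl k) → Fin 2,
        (∏ c, xSign (s c) (y' c)) * graphState G.controlled (Sum.elim x y') =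
        (-1) ^ edgeCount G.graph (fun u v => u.1 < v.1) x *
          ((1 / Real.sqrt 2 : ℝ) : ℂ) ^ (Fintype.card (Node n) + numControl k) *
            quadGaussSum fun c => weight x c + σ c := by
      rw [quadGaussSum, Finset.mul_sum]
      refine Finset.sum_congr rfl fun y' _ => ?_
      simp only [graphState_controlled_apply, xSign_eq_neg_one_pow (hσ _),
        Finset.prod_pow_eq_pow_sum, add_mul, Finset.sum_add_distrib]
      rw [pow_add (-1 : ℂ), pow_add (-1 : ℂ), pow_add (-1 : ℂ), pow_add (-1 : ℂ)]
      ring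
    -- The edges of `G` are counted twice, once in `G` and once in `pairSum (weight x)`.
    have hsign : (-1 : ℂ) ^ edgeCount G.graph (fun u v => u.1 < v.1) x *
        (-1) ^ (h.choose 2 + (h + 1) * ∑ c, (weight x c + σ c) +
          pairSum fun c => weight x c + σ c) =
        (-1) ^ (N + ∑ u : Node n, (x u : ℕ) * τ (Fin.castAdd (k % 2) u.1)) *
          (-1) ^ edgeCount G.complement.graph (fun u v => u.1 < v.1) x := by
      rw [← pow_add, ← pow_add]
      have h1 := edgeCount_add_edgeCount_complement G x
      have h2 : ∑ u : Node n, (x u : ℕ) * τ (Fin.castAdd (k % 2) u.1) =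
          (h + 1) * ∑ c, weight x c + ∑ c, weight x c * ∑ d ∈ Finset.univ.erase c, σ d := by
        rw [← sum_weight_mul, Finset.mul_sum, ← Finset.sum_add_distrib]
        exact Finset.sum_congr rfl fun c _ => by ring
      apply neg_one_pow_eq_of_even_add
      rw [h2, pairSum_add, ← h1, Finset.sum_add_distrib]
      refine ⟨edgeCount G.graph (fun u v => u.1 < v.1) x +
        edgeCount G.complement.graph (fun u v => u.1 < v.1) x + N + (h + 1) * ∑ c, weight x c +
        ∑ c, weight x c * ∑ d ∈ Finset.univ.erase c, σ d, ?_⟩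
      ring
    rw [hsum, quadGaussSum_eq_of_eq hh]
    simp only [tensorState, PiLp.smul_apply, smul_eq_mul, Sum.elim_inl, Sum.elim_inr]
    rw [xKet_apply, zOp_apply, graphState_inter_apply, ← mul_assoc ((-1 : ℂ) ^ _), ← hsign,
      Fintype.card_fin]
    push_cast
    ring
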